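/- Let $L:\mathbb{R}^d\to\mathbb{R}$ be $C^\infty$, $\mu\in(0,1)$, and let $\alpha\ge 1$ be an integer. For a step size $\eta>0$ and $\beta_0\in\mathbb{R}^d$, let $(\beta_k)_{k\ge0}$ be the heavy-ball iterates $$\beta_{k+1}-\beta_k=-\eta\nabla L(\beta_k)+\mu(\beta_k-\beta_{k-1}),\qquad \beta_{-1}=\beta_0 .$$ Define vector fields on $\mathbb{R}^d$ by $G_k=\mu G_{k-1}+\nabla L$ for $k\ge 0$, with $G_{-1}=0$. Put $\gamma_k^{(-1)}=G_k$ for $k\ge 0$, and $\gamma_{-1}^{(\sigma)}=0$ for all $\sigma\ge -1$. Write $\mathbf L^{(k,\sigma)}=\gamma_k^{(\sigma-1)}\cdot\nabla$ for the directional derivative operator, acting componentwise on vector fields, and let $\mathcal S_{m,\sigma}=\{(\sigma_1,\dots,\sigma_m)\in\mathbb{N}^m:\sum_i\sigma_i=\sigma-m+2\}$, where $\mathbb{N}=\{0,1,2,\dots\}$. For $\sigma\ge 0$ and $j,k\ge 0$ set, recursively in $\sigma$, $$\chi_j^{(\sigma)}=\sum_{m=2}^{\sigma+2}\ \sum_{(\sigma_1,\dots,\sigma_m)\in\mathcal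 S_{m,\sigma}}\frac1{m!}\Big[(-1)^m\mathbf L^{(j,\sigma_1)}\cdots\mathbf L^{(j,\sigma_{m-1})}\gamma_j^{(\sigma_m-1)}+\mu\,\mathbf L^{(j-1,\sigma_1)}\cdots\mathbf L^{(j-1,\sigma_{m-1})}\gamma_{j-1}^{(\sigma_m-1)}\Big],$$ $$\gamma_k^{(\sigma)}=\sum_{j=0}^k\mu^{k-j}\chi_j^{(\sigma)},\qquad \gamma_k=\sum_{\sigma=0}^{\alpha-2}\eta^\sigma\gamma_k^{(\sigma)}$$ (so $\gamma_k=0$ if $\alpha=1$). The heavy-ball flow on $[0,N\eta]$ is a continuous curve $\beta$ with $\beta(0)=\beta_0$ and $$\dot\beta=-G_k(\beta)-\eta\,\gamma_k(\beta)\quad\text{on }[k\eta,(k+1)\eta),\qquad 0\le k<N,$$ and its discretization error is $\varepsilon_k=\beta(k\eta)-\beta_k$. Then: 1. $G_k=\frac{1-\mu^{k+1}}{1-\mu}\nabla L$ for all $k\ge 0$. 2. For all $\beta_0$ and $N$ there are $C$ and $\eta_0>0$ such that for every $0<\eta\le\eta_0$ the heavy-ball flow on $[0,N\eta]$ exists and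 every such flow satisfies $\|\varepsilon_{k+1}-\varepsilon_k\|\le C\eta^{\alpha+1}$ for $0\le k<N$ and $\|\varepsilon_k\|\le C\eta^{\alpha}$ for $0\le k\le N$. 3. The estimates are uniform on bounded time intervals: for all $R,T\in\mathbb{R}$ there are $C$ and $\eta_0>0$ such that for all $0<\eta\le\eta_0$, all $N$ with $N\eta\le T$, all $\beta_0$, and every heavy-ball flow $\beta$ on $[0,N\eta]$ with $\beta(0)=\beta_0$ and $\|\beta(t)\|\le R$ on $[0,N\eta]$, the two estimates of item 2 hold with this $C$. -/

import Mathlib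

open scoped ContDiff

noncomputable section

/-- The Lie differential operator `v · ∇` of a vector field `v`, applied to a vector field `f`. -/
def lieOp {E : Type*} [NormedAddCommGroup E] [NormedSpace ℝ E] (v f : E → E) : E → E :=
  fun x => fderiv ℝ f x (v x)

/-- `nestedLie [v₁, …, vₘ] = (v₁ · ∇) ⋯ (vₘ₋₁ · ∇) vₘ`. -/
def nestedLie {E : Type*} [NormedAddCommGroup E] [NormedSpace ℝ E] : List (E → E) → E → E
  | [] => 0
  | [v] => v
  | v :: w :: l => lieOp v (nestedLie (w :: l))

/-- The sequence shifted by one index, `j ↦ f (j - 1)`, with the convention `f (-1) = 0`. -/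
def shiftSeq {E : Type*} [Zero E] (f : ℕ → E → E) : ℕ → E → E
  | 0 => 0
  | j + 1 => f j

/-- `G_k = μ G_{k-1} + ∇L` with `G_{-1} = 0`. -/
def hbG {d : ℕ} (L : EuclideanSpace ℝ (Fin d) → ℝ) (μ : ℝ) :
    ℕ → EuclideanSpace ℝ (Fin d) → EuclideanSpace ℝ (Fin d)
  | 0 => fun x => gradient L x
  | k + 1 => fun x => μ • hbG L μ k x + gradient L x

/-- `χ_j^{(σ)}` built from a family `g`, where `g r k` stands for `γ_k^{(r - 1)}`.
The inner sum runs over all `(σ_1, …, σ_m) ∈ ℕ^m` with `σ_1 + ⋯ + σ_m = σ - m + 2`. -/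
def hbChi {E : Type*} [NormedAddCommGroup E] [NormedSpace ℝ E] (μ : ℝ)
    (g : ℕ → ℕ → E → E) (σ j : ℕ) : E → E :=
  fun x => ∑ m ∈ Finset.Icc 2 (σ + 2), ∑ s ∈ Finset.Nat.antidiagonalTuple m (σ + 2 - m),
    (1 / (m.factorial : ℝ)) •
      ((-1 : ℝ) ^ m • nestedLie (List.ofFn fun i => g (s i) j) x
        + μ • nestedLie (List.ofFn fun i => shiftSeq (g (s i)) j) x)

/-- `hbCoeff L μ r k` is `γ_k^{(r - 1)}`: `γ_k^{(-1)} = G_k` and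
`γ_k^{(σ)} = ∑_{j ≤ k} μ^{k-j} χ_j^{(σ)}`. The cut-off `r < σ + 1` only makes the recursion visibly
well-founded; it has no effect, see `hbCoeff_succ`. -/
def hbCoeff {d : ℕ} (L : EuclideanSpace ℝ (Fin d) → ℝ) (μ : ℝ) :
    ℕ → ℕ → EuclideanSpace ℝ (Fin d) → EuclideanSpace ℝ (Fin d)
  | 0 => hbG L μ
  | σ + 1 => fun k x => ∑ j ∈ Finset.range (k + 1),
      μ ^ (k - j) • hbChi μ (fun r => if _h : r < σ + 1 then hbCoeff L μ r else 0) σ j x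

theorem hbChi_congr {E : Type*} [NormedAddCommGroup E] [NormedSpace ℝ E] (μ : ℝ)
    (g g' : ℕ → ℕ → E → E) (σ j : ℕ) (h : ∀ r, r < σ + 1 → g r = g' r) :
    hbChi μ g σ j = hbChi μ g' σ j := by
  funext x
  unfold hbChi
  refine Finset.sum_congr rfl fun m hm => Finset.sum_congr rfl fun s hs => ?_
  have hs' : ∀ i, g (s i) = g' (s i) := fun i => by
    apply h
    have h1 := Finset.Nat.mem_antidiagonalTuple.1 hs
    have h2 : s i ≤ ∑ i, s i := Finset.single_le_sum (fun _ _ => Nat.zero_le _) (Finset.mem_univ i)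
    have h3 := (Finset.mem_Icc.1 hm).1
    omega
  simp only [hs']

theorem hbCoeff_succ {d : ℕ} (L : EuclideanSpace ℝ (Fin d) → ℝ) (μ : ℝ) (σ k : ℕ)
    (x : EuclideanSpace ℝ (Fin d)) :
    hbCoeff L μ (σ + 1) k x =
      ∑ j ∈ Finset.range (k + 1), μ ^ (k - j) • hbChi μ (hbCoeff L μ) σ j x := by
  rw [hbCoeff]
  refine Finset.sum_congr rfl fun j _ => ?_
  rw [hbChi_congr μ _ (hbCoeff L μ) σ j]
  intro r hr
  simp [hr]

/-- The counter term `γ_k = ∑_{σ=0}^{α-2} η^σ γ_k^{(σ)}` (the empty sum for `α = 1`). -/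
def hbGamma {d : ℕ} (L : EuclideanSpace ℝ (Fin d) → ℝ) (μ : ℝ) (α : ℕ) (η : ℝ) (k : ℕ)
    (x : EuclideanSpace ℝ (Fin d)) : EuclideanSpace ℝ (Fin d) :=
  ∑ σ ∈ Finset.range (α - 1), η ^ σ • hbCoeff L μ (σ + 1) k x

/-- `β` solves the heavy-ball flow on the first `N` pieces: it is continuous on `[0, Nη]`, starts
at `β₀`, and `β' = -G_k(β) - η γ_k(β)` on each `[kη, (k+1)η)`. -/
structure IsHBFlow {d : ℕ} (L : EuclideanSpace ℝ (Fin d) → ℝ) (μ : ℝ) (α : ℕ) (η : ℝ) (N : ℕ)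
    (β₀ : EuclideanSpace ℝ (Fin d)) (β : ℝ → EuclideanSpace ℝ (Fin d)) : Prop where
  init : β 0 = β₀
  cont : ContinuousOn β (Set.Icc 0 (N * η))
  deriv : ∀ k : ℕ, k < N → ∀ t ∈ Set.Ico (k * η) ((k + 1) * η),
    HasDerivWithinAt β (-hbG L μ k (β t) - η • hbGamma L μ α η k (β t))
      (Set.Ico (k * η) ((k + 1) * η)) t

/-- The discrete heavy-ball iterates `β_{k+1} - β_k = -η ∇L(β_k) + μ (β_k - β_{k-1})`, started
without momentum, so that `β_1 = β_0 - η ∇L(β_0)`. -/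
def hbIter {d : ℕ} (L : EuclideanSpace ℝ (Fin d) → ℝ) (μ η : ℝ) (β₀ : EuclideanSpace ℝ (Fin d)) :
    ℕ → EuclideanSpace ℝ (Fin d)
  | 0 => β₀
  | 1 => β₀ - η • gradient L β₀
  | k + 2 => hbIter L μ η β₀ (k + 1) - η • gradient L (hbIter L μ η β₀ (k + 1))
      + μ • (hbIter L μ η β₀ (k + 1) - hbIter L μ η β₀ k)

/-- The discretization error `ε_k = β(kη) - β_k`. -/
def discErr {d : ℕ} (L : EuclideanSpace ℝ (Fin d) → ℝ) (μ η : ℝ) (β₀ : EuclideanSpace ℝ (Fin d))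
    (β : ℝ → EuclideanSpace ℝ (Fin d)) (k : ℕ) : EuclideanSpace ℝ (Fin d) :=
  β (k * η) - hbIter L μ η β₀ k

end

/-! On the `k`-th piece the flow has velocity `-F_k`, where `F_k` is the sum of `η^r γ_k^{(r-1)}`
over `r < α`. Seen from `β(kη)`, the next grid value is the forward flow of `-F_k` and the previous
one the backward flow of `-F_{k-1}`, so by Lie series both equal, up to `O(η^{α+1})`, Taylor
polynomials `e^{-ηF_k} id` and `e^{ηF_{k-1}} id`. The heavy-ball rule holds along the flow to this
order if `e^{-ηF_k} id + μ e^{ηF_{k-1}} id = (1+μ) id - η∇L` modulo `η^{α+1}`. Comparing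
coefficients, order one is the recursion for `G_k`, and order `σ+2` is `γ_k^{(σ)} = μ γ_{k-1}^{(σ)}
+ χ_k^{(σ)}`, which the definition solves (`hb_order_condition`, `hb_lieTaylor`).

The constants must not depend on `k`. Since `μ < 1`, every `γ_k^{(σ)}` is a finite combination of
fixed smooth fields with coefficients bounded in `k`; `SmoothFamily` records this and is closed
under all operations involved. Hence the local error is uniform on balls
(`exists_local_error_bound`).

Subtracting the two recursions, the increments of the error contract by `μ` and are driven by `η`
times the error plus `O(η^{α+1})`; `momentum_gronwall` turns this into the global bounds. For fixed
`N` and small `η`, a speed bound confines the flow to a ball, which also yields existence piece by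
piece. -/

/-! ### Vector fields with smoothness bounds uniform in a parameter -/

section SmoothFamily

variable {ι κ E : Type*} [NormedAddCommGroup E] [NormedSpace ℝ E]

/-- Finite sums `∑ a_i • h_i` of fixed smooth vector fields `h_i` with bounded coefficients `a_i`
depending on a parameter. -/
inductive SmoothFamily : (ι → E → E) → Prop
  | term (a : ι → ℝ) (A : ℝ) (ha : ∀ i, |a i| ≤ A) (h : E → E) (hh : ContDiff ℝ ∞ h) :
      SmoothFamily fun i x => a i • h x
  | add {f g : ι → E → E} (hf : SmoothFamily f) (hg : SmoothFamily g) :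
      SmoothFamily fun i x => f i x + g i x

namespace SmoothFamily

theorem congr {f g : ι → E → E} (hf : SmoothFamily f) (h : ∀ i x, g i x = f i x) :
    SmoothFamily g := by
  have : g = f := by funext i x; exact h i x
  rwa [this]

theorem const {h : E → E} (hh : ContDiff ℝ ∞ h) : SmoothFamily fun _ : ι => h :=
  (term (fun _ : ι => (1 : ℝ)) 1 (by simp) h hh).congr (by simp)

theorem zero : SmoothFamily fun (_ : ι) (_ : E) => (0 : E) :=
  const contDiff_const

theorem contDiff {f : ι → E → E} (hf : SmoothFamily f) (i : ι) : ContDiff ℝ ∞ (f i) := by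
  induction hf with
  | term a A ha h hh => exact hh.const_smul (a i)
  | add _ _ ihf ihg => exact ihf.add ihg

theorem differentiable {f : ι → E → E} (hf : SmoothFamily f) (i : ι) : Differentiable ℝ (f i) :=
  (hf.contDiff i).differentiable (by simp)

theorem smul {f : ι → E → E} (hf : SmoothFamily f) (a : ι → ℝ) (A : ℝ) (ha : ∀ i, |a i| ≤ A) :
    SmoothFamily fun i x => a i • f i x := by
  induction hf with
  | term b B hb h hh =>
    refine (term (fun i => a i * b i) (A * B) (fun i => ?_) h hh).congr fun i x => by
      rw [mul_smul]
    rw [abs_mul]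
    exact mul_le_mul (ha i) (hb i) (abs_nonneg _) ((abs_nonneg _).trans (ha i))
  | add _ _ ihf ihg => exact (ihf.add ihg).congr fun i x => smul_add _ _ _

theorem const_smul {f : ι → E → E} (hf : SmoothFamily f) (a : ℝ) :
    SmoothFamily fun i x => a • f i x :=
  hf.smul (fun _ => a) |a| fun _ => le_rfl

theorem sum {J : Type*} (s : Finset J) {f : J → ι → E → E} (hf : ∀ j ∈ s, SmoothFamily (f j)) :
    SmoothFamily fun i x => ∑ j ∈ s, f j i x := by
  classical
  induction s using Finset.induction_on with
  | empty => simpa using zero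
  | insert j s hj ih =>
    refine ((hf j (by simp)).add (ih fun k hk => hf k (by simp [hk]))).congr fun i x => ?_
    rw [Finset.sum_insert hj]

theorem reindex {f : ι → E → E} (hf : SmoothFamily f) (φ : κ → ι) :
    SmoothFamily fun k => f (φ k) := by
  induction hf with
  | term a A ha h hh => exact term (fun k => a (φ k)) A (fun k => ha _) h hh
  | add _ _ ihf ihg => exact ihf.add ihg

/-- The operator is bilinear and the coefficients do not depend on the point, so they factor out and
only Lie derivatives between fixed smooth fields remain. -/
theorem lieOp {f g : ι → E → E} (hf : SmoothFamily f) (hg : SmoothFamily g) :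
    SmoothFamily fun i => lieOp (f i) (g i) := by
  induction hg with
  | term b B hb h hh =>
    have key : SmoothFamily fun i x => fderiv ℝ h x (f i x) := by
      induction hf with
      | term a A ha v hv =>
        refine (term a A ha (fun x => fderiv ℝ h x (v x)) ?_).congr fun i x => by simp
        exact (hh.fderiv_right (m := ∞) (by simp)).clm_apply hv
      | add _ _ ihf ihg => exact (ihf.add ihg).congr fun i x => by simp
    refine (key.smul b B hb).congr fun i x => ?_
    have hd : DifferentiableAt ℝ h x := (hh.differentiable (by simp)) x
    simp only [_root_.lieOp]
    rw [fderiv_fun_const_smul hd]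
    rfl
  | add hg₁ hg₂ ih₁ ih₂ =>
    refine (ih₁.add ih₂).congr fun i x => ?_
    simp only [_root_.lieOp]
    rw [fderiv_fun_add (hg₁.differentiable i x) (hg₂.differentiable i x)]
    rfl

theorem shiftSeq {f : ℕ → E → E} (hf : SmoothFamily f) : SmoothFamily (shiftSeq f) := by
  induction hf with
  | term a A ha h hh =>
    refine (term (fun k => if k = 0 then 0 else a (k - 1)) A (fun k => ?_) h hh).congr
      fun k x => ?_
    · split_ifs
      · simpa using (abs_nonneg _).trans (ha 0)
      · exact ha _
    · cases k <;> simp [_root_.shiftSeq]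
  | add _ _ ihf ihg =>
    refine (ihf.add ihg).congr fun k x => ?_
    cases k <;> simp [_root_.shiftSeq]

/-- The convolution acts on the scalar coefficients alone, and the geometric series bounds the
result independently of `k`. This is what makes the counter terms uniform in the iteration number.
-/
theorem geomConv {f : ℕ → E → E} (hf : SmoothFamily f) {μ : ℝ} (h0 : 0 ≤ μ) (h1 : μ < 1) :
    SmoothFamily fun k x => ∑ j ∈ Finset.range (k + 1), μ ^ (k - j) • f j x := by
  induction hf with
  | term a A ha h hh =>
    refine (term (fun k => ∑ j ∈ Finset.range (k + 1), μ ^ (k - j) * a j) ((1 - μ)⁻¹ * A)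
      (fun k => ?_) h hh).congr fun k x => ?_
    · calc |∑ j ∈ Finset.range (k + 1), μ ^ (k - j) * a j|
          ≤ ∑ j ∈ Finset.range (k + 1), |μ ^ (k - j) * a j| := Finset.abs_sum_le_sum_abs _ _
        _ ≤ ∑ j ∈ Finset.range (k + 1), μ ^ (k - j) * A := by
            refine Finset.sum_le_sum fun j _ => ?_
            rw [abs_mul, abs_of_nonneg (pow_nonneg h0 _)]
            exact mul_le_mul_of_nonneg_left (ha j) (pow_nonneg h0 _)
        _ = (∑ j ∈ Finset.range (k + 1), μ ^ j) * A := by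
            rw [← Finset.sum_mul]
            congr 1
            simpa using Finset.sum_range_reflect (fun j => μ ^ j) (k + 1)
        _ ≤ (1 - μ)⁻¹ * A := by
            have hA : 0 ≤ A := (abs_nonneg _).trans (ha 0)
            refine mul_le_mul_of_nonneg_right ?_ hA
            rw [← tsum_geometric_of_lt_one h0 h1]
            exact (summable_geometric_of_lt_one h0 h1).sum_le_tsum _ fun j _ => pow_nonneg h0 j
    · simp only [smul_smul, Finset.sum_smul]
  | add _ _ ihf ihg =>
    refine (ihf.add ihg).congr fun k x => ?_
    simp only [smul_add, Finset.sum_add_distrib]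

theorem exists_bound [ProperSpace E] {f : ι → E → E} (hf : SmoothFamily f) (R : ℝ) :
    ∃ C, 0 ≤ C ∧ ∀ i x, ‖x‖ ≤ R → ‖f i x‖ ≤ C := by
  induction hf with
  | term a A ha h hh =>
    obtain ⟨C, hC⟩ := (isCompact_closedBall (0 : E) R).exists_bound_of_continuousOn
      hh.continuous.continuousOn
    refine ⟨|A| * |C|, by positivity, fun i x hx => ?_⟩
    rw [norm_smul]
    exact mul_le_mul ((ha i).trans (le_abs_self _)) ((hC x (by simpa using hx)).trans
      (le_abs_self _)) (norm_nonneg _) (abs_nonneg _)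
  | add _ _ ihf ihg =>
    obtain ⟨C, h0, hC⟩ := ihf
    obtain ⟨D, h0', hD⟩ := ihg
    exact ⟨C + D, by positivity, fun i x hx =>
      (norm_add_le _ _).trans (add_le_add (hC i x hx) (hD i x hx))⟩

theorem exists_lipschitz [ProperSpace E] {f : ι → E → E} (hf : SmoothFamily f) (R : ℝ) :
    ∃ K, 0 ≤ K ∧ ∀ i x y, ‖x‖ ≤ R → ‖y‖ ≤ R → ‖f i x - f i y‖ ≤ K * ‖x - y‖ := by
  induction hf with
  | term a A ha h hh =>
    obtain ⟨C, hC⟩ := (isCompact_closedBall (0 : E) R).exists_bound_of_continuousOn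
      (hh.continuous_fderiv (by simp)).continuousOn
    refine ⟨|A| * |C|, by positivity, fun i x y hx hy => ?_⟩
    have hxy : ‖h x - h y‖ ≤ |C| * ‖x - y‖ :=
      (convex_closedBall (0 : E) R).norm_image_sub_le_of_norm_fderiv_le (𝕜 := ℝ)
        (fun z _ => hh.differentiable (by simp) z) (fun z hz => (hC z hz).trans (le_abs_self _))
        (by simpa using hy) (by simpa using hx)
    rw [← smul_sub, norm_smul, mul_assoc]
    exact mul_le_mul ((ha i).trans (le_abs_self _)) hxy (norm_nonneg _) (abs_nonneg _)
  | @add f g _ _ ihf ihg =>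
    obtain ⟨C, h0, hC⟩ := ihf
    obtain ⟨D, h0', hD⟩ := ihg
    refine ⟨C + D, by positivity, fun i x y hx hy => ?_⟩
    rw [add_sub_add_comm, add_mul]
    exact (norm_add_le _ _).trans (add_le_add (hC i x y hx hy) (hD i x y hx hy))

theorem lieOp_iterate {f : ι → E → E} (hf : SmoothFamily f) (m : ℕ) :
    SmoothFamily fun i => (_root_.lieOp (f i))^[m] id := by
  induction m with
  | zero => exact const contDiff_id
  | succ m ih =>
    simp only [Function.iterate_succ_apply']
    exact hf.lieOp ih

end SmoothFamily

end SmoothFamily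

/-! ### Coefficients of formal Lie series -/

section LieCoeff

variable {ι E : Type*} [NormedAddCommGroup E] [NormedSpace ℝ E]

theorem lieOp_id (v : E → E) : lieOp v id = v := by
  funext x
  simp [lieOp]

/-- The innermost field is itself `(v · ∇) id`, so a nested product of `m` fields is `m` operators
applied to the identity, the form in which terms of a Lie series appear. -/
theorem nestedLie_eq_foldr : ∀ {l : List (E → E)}, l ≠ [] → nestedLie l = l.foldr lieOp id
  | [v], _ => by simp [nestedLie, lieOp_id]
  | v :: w :: l, _ => by
    rw [nestedLie, nestedLie_eq_foldr (by simp : w :: l ≠ [])]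
    rfl

theorem lieOp_sum {J : Type*} (s : Finset J) (v : E → E) {f : J → E → E}
    (hf : ∀ j ∈ s, Differentiable ℝ (f j)) :
    lieOp v (fun x => ∑ j ∈ s, f j x) = fun x => ∑ j ∈ s, lieOp v (f j) x := by
  funext x
  simp only [lieOp]
  rw [fderiv_fun_sum fun j hj => hf j hj x]
  simp

/-- The coefficient of `t ^ p` in the formal expansion of `((∑ r, t ^ r • g r) · ∇) ^ m id`. -/
noncomputable def lieCoeff (g : ℕ → E → E) : ℕ → ℕ → E → E
  | 0, 0 => id
  | 0, _ + 1 => 0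
  | m + 1, p => fun x => ∑ ab ∈ Finset.HasAntidiagonal.antidiagonal p, lieOp (g ab.1) (lieCoeff g m ab.2) x

theorem lieCoeff_zero_zero (g : ℕ → E → E) : lieCoeff g 0 0 = id :=
  rfl

theorem lieCoeff_zero_succ (g : ℕ → E → E) (p : ℕ) : lieCoeff g 0 (p + 1) = 0 :=
  rfl

theorem lieCoeff_succ_apply (g : ℕ → E → E) (m p : ℕ) (x : E) :
    lieCoeff g (m + 1) p x = ∑ ab ∈ Finset.HasAntidiagonal.antidiagonal p,
      lieOp (g ab.1) (lieCoeff g m ab.2) x :=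
  rfl

theorem lieCoeff_one (g : ℕ → E → E) (p : ℕ) : lieCoeff g 1 p = g p := by
  funext x
  rw [lieCoeff_succ_apply, Finset.sum_eq_single (p, 0)]
  · simp [lieCoeff, lieOp_id]
  · rintro ⟨a, b⟩ hab hne
    obtain ⟨b, rfl⟩ := Nat.exists_eq_succ_of_ne_zero (n := b) (by
      rintro rfl
      simp_all)
    simp [lieCoeff, lieOp]
  · simp

theorem SmoothFamily.lieCoeff {g : ℕ → ι → E → E} (hg : ∀ r, SmoothFamily (g r)) (m p : ℕ) :
    SmoothFamily fun i => lieCoeff (fun r => g r i) m p := by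
  induction m generalizing p with
  | zero =>
    cases p with
    | zero => exact SmoothFamily.const contDiff_id
    | succ p => exact SmoothFamily.zero
  | succ m ih =>
    exact SmoothFamily.sum _ (f := fun (ab : ℕ × ℕ) i =>
      _root_.lieOp (g ab.1 i) (_root_.lieCoeff (fun r => g r i) m ab.2)) fun ab _ => (hg ab.1).lieOp (ih ab.2)

theorem sum_antidiagonalTuple_succ {M : Type*} [AddCommMonoid M] (m p : ℕ)
    (φ : (Fin (m + 1) → ℕ) → M) :
    ∑ s ∈ Finset.Nat.antidiagonalTuple (m + 1) p, φ s =
      ∑ ab ∈ Finset.HasAntidiagonal.antidiagonal p, ∑ s ∈ Finset.Nat.antidiagonalTuple m ab.2,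
        φ (Fin.cons ab.1 s) := by
  rw [Finset.sum_sigma']
  refine Finset.sum_nbij' (fun s => ⟨(s 0, p - s 0), Fin.tail s⟩)
    (fun a => Fin.cons a.1.1 a.2) ?_ ?_ ?_ ?_ ?_
  · intro s hs
    rw [Finset.Nat.mem_antidiagonalTuple, Fin.sum_univ_succ] at hs
    simp only [Finset.mem_sigma, Finset.HasAntidiagonal.mem_antidiagonal, Finset.Nat.mem_antidiagonalTuple,
      Fin.tail]
    omega
  · rintro ⟨⟨a, b⟩, s⟩ h
    simp only [Finset.mem_sigma, Finset.HasAntidiagonal.mem_antidiagonal, Finset.Nat.mem_antidiagonalTuple] at h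
    simp only [Finset.Nat.mem_antidiagonalTuple, Fin.sum_univ_succ, Fin.cons_zero, Fin.cons_succ]
    omega
  · intro s _
    exact Fin.cons_self_tail s
  · rintro ⟨⟨a, b⟩, s⟩ h
    simp only [Finset.mem_sigma, Finset.HasAntidiagonal.mem_antidiagonal] at h
    have : p - a = b := by omega
    simp [this]
  · intro s _
    simp

theorem lieCoeff_eq_sum_foldr {g : ℕ → E → E} (hg : ∀ r, ContDiff ℝ ∞ (g r)) (m p : ℕ) (x : E) :
    lieCoeff g m p x = ∑ s ∈ Finset.Nat.antidiagonalTuple m p,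
      (List.ofFn fun i => g (s i)).foldr lieOp id x := by
  induction m generalizing p x with
  | zero => cases p <;> simp [lieCoeff]
  | succ m ih =>
    rw [sum_antidiagonalTuple_succ, lieCoeff_succ_apply]
    refine Finset.sum_congr rfl fun ab _ => ?_
    -- Smoothness of the inner products allows the outer derivative to pass through the finite sum.
    have hd (l : List (E → E)) (hl : ∀ v ∈ l, ContDiff ℝ ∞ v) :
        ContDiff ℝ ∞ (l.foldr lieOp id) := by
      induction l with
      | nil => exact contDiff_id
      | cons v l ihl =>
        exact ((ihl fun w hw => hl w (by simp [hw])).fderiv_right (m := ∞) (by simp)).clm_apply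
          (hl v (by simp))
    rw [funext (ih ab.2), lieOp_sum]
    · simp [List.ofFn_succ]
    · intro s _
      refine (hd _ fun v hv => ?_).differentiable (by simp)
      obtain ⟨i, rfl⟩ := (List.mem_ofFn' _ _).1 hv
      exact hg _

theorem lieCoeff_eq_sum_nestedLie {g : ℕ → E → E} (hg : ∀ r, ContDiff ℝ ∞ (g r)) {m : ℕ}
    (hm : m ≠ 0) (p : ℕ) (x : E) :
    lieCoeff g m p x = ∑ s ∈ Finset.Nat.antidiagonalTuple m p,
      nestedLie (List.ofFn fun i => g (s i)) x := by
  rw [lieCoeff_eq_sum_foldr hg]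
  refine Finset.sum_congr rfl fun s _ => ?_
  rw [nestedLie_eq_foldr (by simpa using hm)]

theorem hbChi_eq_lieCoeff (μ : ℝ) {g : ℕ → ℕ → E → E} (hg : ∀ r, SmoothFamily (g r)) (σ j : ℕ)
    (x : E) :
    hbChi μ g σ j x = ∑ m ∈ Finset.Icc 2 (σ + 2), (1 / (m.factorial : ℝ)) •
      ((-1 : ℝ) ^ m • lieCoeff (fun r => g r j) m (σ + 2 - m) x
        + μ • lieCoeff (fun r => shiftSeq (g r) j) m (σ + 2 - m) x) := by
  refine Finset.sum_congr rfl fun m hm => ?_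
  have hm0 : m ≠ 0 := by have := (Finset.mem_Icc.1 hm).1; omega
  rw [lieCoeff_eq_sum_nestedLie (fun r => (hg r).contDiff j) hm0,
    lieCoeff_eq_sum_nestedLie (fun r => (hg r).shiftSeq.contDiff j) hm0]
  simp only [Finset.smul_sum, Finset.sum_add_distrib, smul_add]

theorem SmoothFamily.hbChi (μ : ℝ) {g : ℕ → ℕ → E → E} (hg : ∀ r, SmoothFamily (g r)) (σ : ℕ) :
    SmoothFamily (hbChi μ g σ) := by
  refine (SmoothFamily.sum (Finset.Icc 2 (σ + 2)) (f := fun m j x => (1 / (m.factorial : ℝ)) •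
      ((-1 : ℝ) ^ m • _root_.lieCoeff (fun r => g r j) m (σ + 2 - m) x
        + μ • _root_.lieCoeff (fun r => _root_.shiftSeq (g r) j) m (σ + 2 - m) x))
    fun m _ => ?_).congr (hbChi_eq_lieCoeff μ hg σ)
  exact (((SmoothFamily.lieCoeff hg _ _).const_smul _).add
    ((SmoothFamily.lieCoeff (fun r => (hg r).shiftSeq) _ _).const_smul _)).const_smul _

end LieCoeff

/-! ### Calculus modulo powers of the step size -/

section EqModPow

variable {ι E : Type*} [NormedAddCommGroup E] [NormedSpace ℝ E]

/-- Equality of two families of vector fields up to `η ^ n` times a smooth family. -/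
def EqModPow (η : ι → ℝ) (n : ℕ) (f g : ι → E → E) : Prop :=
  ∃ ρ : ι → E → E, SmoothFamily ρ ∧ ∀ i x, f i x = g i x + η i ^ n • ρ i x

namespace EqModPow

variable {η : ι → ℝ} {n : ℕ} {f f' g g' : ι → E → E}

theorem of_eq (h : ∀ i x, f i x = g i x) : EqModPow η n f g :=
  ⟨_, SmoothFamily.zero, by simpa using h⟩

theorem trans {k : ι → E → E} (h : EqModPow η n f g) (h' : EqModPow η n g k) :
    EqModPow η n f k := by
  obtain ⟨ρ, hρ, h⟩ := h
  obtain ⟨τ, hτ, h'⟩ := h'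
  exact ⟨_, hτ.add hρ, fun i x => by rw [h, h', smul_add, add_assoc]⟩

theorem add (h : EqModPow η n f g) (h' : EqModPow η n f' g') :
    EqModPow η n (fun i x => f i x + f' i x) (fun i x => g i x + g' i x) := by
  obtain ⟨ρ, hρ, h⟩ := h
  obtain ⟨τ, hτ, h'⟩ := h'
  exact ⟨_, hρ.add hτ, fun i x => by simp only [h, h', smul_add]; abel⟩

theorem sum {J : Type*} (s : Finset J) {f g : J → ι → E → E}
    (h : ∀ j ∈ s, EqModPow η n (f j) (g j)) :
    EqModPow η n (fun i x => ∑ j ∈ s, f j i x) (fun i x => ∑ j ∈ s, g j i x) := by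
  choose! ρ hρ h using h
  refine ⟨_, SmoothFamily.sum s hρ, fun i x => ?_⟩
  rw [Finset.smul_sum, ← Finset.sum_add_distrib]
  exact Finset.sum_congr rfl fun j hj => h j hj i x

theorem const_smul (h : EqModPow η n f g) (a : ℝ) :
    EqModPow η n (fun i x => a • f i x) (fun i x => a • g i x) := by
  obtain ⟨ρ, hρ, h⟩ := h
  exact ⟨_, hρ.const_smul a, fun i x => by simp only [h, smul_add, smul_comm a]⟩

theorem pow_smul (h : EqModPow η n f g) (m : ℕ) :
    EqModPow η (m + n) (fun i x => η i ^ m • f i x) (fun i x => η i ^ m • g i x) := by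
  obtain ⟨ρ, hρ, h⟩ := h
  exact ⟨ρ, hρ, fun i x => by simp only [h, smul_add, pow_add, mul_smul]⟩

theorem pow_smul_zero (hη : ∀ i, |η i| ≤ 1) (hf : SmoothFamily f) {m : ℕ} (hm : n ≤ m) :
    EqModPow η n (fun i x => η i ^ m • f i x) (fun _ _ => 0) := by
  refine ⟨_, hf.smul (fun i => η i ^ (m - n)) 1 fun i => ?_, fun i x => ?_⟩
  · rw [abs_pow]
    exact pow_le_one₀ (abs_nonneg _) (hη i)
  · rw [zero_add, smul_smul, ← pow_add, Nat.add_sub_cancel' hm]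

theorem sum_range_of_le {f : ℕ → ι → E → E} {k N : ℕ} (hkN : k ≤ N)
    (h : ∀ r, k ≤ r → EqModPow η n (f r) fun _ _ => 0) :
    EqModPow η n (fun i x => ∑ r ∈ Finset.range N, f r i x)
      (fun i x => ∑ r ∈ Finset.range k, f r i x) := by
  induction N, hkN using Nat.le_induction with
  | base => exact of_eq fun _ _ => rfl
  | succ N hN ih =>
    refine (of_eq fun i x => Finset.sum_range_succ _ N).trans ((ih.add (h N hN)).trans ?_)
    exact of_eq fun i x => add_zero _

/-- With `f = f' + η^n ρ` and `g = g' + η^n τ`, the difference is `η^n` times `(f · ∇)τ + (ρ ·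
∇)g'`, again a smooth family. -/
theorem lieOp (hf : SmoothFamily f) (hg' : SmoothFamily g') (h : EqModPow η n f f')
    (h' : EqModPow η n g g') :
    EqModPow η n (fun i => lieOp (f i) (g i)) (fun i => lieOp (f' i) (g' i)) := by
  obtain ⟨ρ, hρ, h⟩ := h
  obtain ⟨τ, hτ, h'⟩ := h'
  refine ⟨_, (hf.lieOp hτ).add (hρ.lieOp hg'), fun i x => ?_⟩
  have hg : g i = fun x => g' i x + η i ^ n • τ i x := funext (h' i)
  simp only [_root_.lieOp]
  rw [hg, fderiv_fun_add (hg'.differentiable i x) ((hτ.differentiable i x).fun_const_smul _),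
    fderiv_fun_const_smul (hτ.differentiable i x), _root_.add_apply,
    _root_.smul_apply, smul_add, add_comm (η i ^ n • _), ← add_assoc]
  congr 1
  rw [h i x, map_add, map_smul]

end EqModPow

theorem lieOp_pow_sum {g : ℕ → E → E} {c : ℕ → E → E} (hc : ∀ p, Differentiable ℝ (c p)) (t : ℝ)
    (n : ℕ) (x : E) :
    lieOp (fun x => ∑ r ∈ Finset.range n, t ^ r • g r x)
        (fun x => ∑ p ∈ Finset.range n, t ^ p • c p x) x =
      ∑ r ∈ Finset.range n, ∑ p ∈ Finset.range n, t ^ (r + p) • lieOp (g r) (c p) x := by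
  rw [lieOp_sum _ _ fun p _ => (hc p).fun_const_smul (t ^ p), Finset.sum_comm]
  refine Finset.sum_congr rfl fun p _ => ?_
  simp only [lieOp]
  rw [fderiv_fun_const_smul (hc p x), map_sum]
  refine Finset.sum_congr rfl fun r _ => ?_
  rw [map_smul, _root_.smul_apply, smul_smul, pow_add]

/-- Once an operator is applied, `hnm` forces `n ≤ α`, so truncating the field at degree `α` loses
nothing modulo `η^n`. With no operator applied, `hn` keeps the constant term `id` in the sum. -/
theorem eqModPow_lieOp_iterate {η : ι → ℝ} (hη : ∀ i, |η i| ≤ 1) {g : ℕ → ι → E → E}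
    (hg : ∀ r, SmoothFamily (g r)) (α : ℕ) {n : ℕ} (hn : 1 ≤ n) {m : ℕ} (hnm : n + m ≤ α + 1) :
    EqModPow η n
      (fun i => (lieOp (fun x => ∑ r ∈ Finset.range α, η i ^ r • g r i x))^[m] id)
      (fun i x => ∑ p ∈ Finset.range n, η i ^ p • lieCoeff (fun r => g r i) m p x) := by
  have hpow (r : ℕ) : SmoothFamily fun i x => η i ^ r • g r i x :=
    (hg r).smul _ 1 fun i => by
      rw [abs_pow]; exact pow_le_one₀ (abs_nonneg _) (hη i)
  have hpc (m r : ℕ) : SmoothFamily fun i x => η i ^ r • lieCoeff (fun r => g r i) m r x :=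
    (SmoothFamily.lieCoeff hg m r).smul _ 1 fun i => by
      rw [abs_pow]; exact pow_le_one₀ (abs_nonneg _) (hη i)
  induction m with
  | zero =>
    refine EqModPow.of_eq fun i x => ?_
    obtain ⟨n, rfl⟩ := Nat.exists_eq_add_of_le' hn
    simp [Finset.sum_range_succ', lieCoeff]
  | succ m ih =>
    have hF : EqModPow η n (fun i x => ∑ r ∈ Finset.range α, η i ^ r • g r i x)
        (fun i x => ∑ r ∈ Finset.range n, η i ^ r • g r i x) := by
      refine EqModPow.sum_range_of_le (f := fun r i x => η i ^ r • g r i x) (by omega)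
        fun r hr => EqModPow.pow_smul_zero hη (hg r) hr
    simp only [Function.iterate_succ_apply']
    refine (EqModPow.lieOp (SmoothFamily.sum _ fun r _ => hpow r)
      (SmoothFamily.sum _ fun r _ => hpc m r) hF (ih (by omega))).trans ?_
    refine (EqModPow.of_eq fun i x => lieOp_pow_sum
      (fun p => (SmoothFamily.lieCoeff hg m p).differentiable i) (η i) n x).trans ?_
    refine (EqModPow.sum (Finset.range n) (g := fun r i x => ∑ p ∈ Finset.range (n - r),
      η i ^ (r + p) • lieOp (g r i) (lieCoeff (fun r => g r i) m p) x) fun r hr => ?_).trans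
        (EqModPow.of_eq fun i x => ?_)
    · refine EqModPow.sum_range_of_le (f := fun p i x => η i ^ (r + p) •
        lieOp (g r i) (lieCoeff (fun r => g r i) m p) x) (Nat.sub_le n r) fun p hp => ?_
      exact EqModPow.pow_smul_zero hη ((hg r).lieOp (SmoothFamily.lieCoeff hg m p)) (by omega)
    · rw [← Finset.sum_range_diag_flip n fun r p =>
        η i ^ (r + p) • lieOp (g r i) (lieCoeff (fun r => g r i) m p) x]
      refine Finset.sum_congr rfl fun q _ => ?_
      rw [lieCoeff_succ_apply, Finset.Nat.sum_antidiagonal_eq_sum_range_succ_mk, Finset.smul_sum]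
      refine Finset.sum_congr rfl fun r hr => ?_
      have : r + (q - r) = q := by have := Finset.mem_range.1 hr; omega
      simp only [this]

end EqModPow

/-! ### Expanding the Taylor polynomial of a flow in powers of the step -/

section Expansion

variable {ι E : Type*} [NormedAddCommGroup E] [NormedSpace ℝ E]

/-- The polynomial `∑_{r < α} η ^ r • g r` in `η` with coefficients a sequence of vector fields. -/
noncomputable def powField (g : ℕ → E → E) (α : ℕ) (η : ℝ) : E → E :=
  fun x => ∑ r ∈ Finset.range α, η ^ r • g r x

theorem SmoothFamily.powField {η : ι → ℝ} (hη : ∀ i, |η i| ≤ 1) {g : ℕ → ι → E → E}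
    (hg : ∀ r, SmoothFamily (g r)) (α : ℕ) :
    SmoothFamily fun i => powField (fun r => g r i) α (η i) :=
  SmoothFamily.sum _ fun r _ => (hg r).smul (fun i => η i ^ r) 1 fun i => by
    rw [abs_pow]; exact pow_le_one₀ (abs_nonneg _) (hη i)

/-- The Taylor polynomial of degree `n` at time `t` of the flow of `F`. -/
noncomputable def lieTaylor (F : E → E) (n : ℕ) (t : ℝ) : E → E :=
  fun x => ∑ m ∈ Finset.range (n + 1), (t ^ m / (m.factorial : ℝ)) • (lieOp F)^[m] id x

/-- The `m`-th Taylor term already carries `η^m`, so its iterate is needed only modulo `η^(α+1-m)`.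
Regrouping by total degree `q = m + p` gives the result. -/
theorem eqModPow_lieTaylor {η : ι → ℝ} (hη : ∀ i, |η i| ≤ 1) {g : ℕ → ι → E → E}
    (hg : ∀ r, SmoothFamily (g r)) (α : ℕ) (ε : ℝ) :
    EqModPow η (α + 1)
      (fun i => lieTaylor (powField (fun r => g r i) α (η i)) α (ε * η i))
      (fun i x => ∑ q ∈ Finset.range (α + 1), η i ^ q • ∑ m ∈ Finset.range (q + 1),
        (ε ^ m / (m.factorial : ℝ)) • lieCoeff (fun r => g r i) m (q - m) x) := by
  refine (EqModPow.sum (Finset.range (α + 1)) (g := fun m i x =>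
    (ε ^ m / (m.factorial : ℝ)) • (η i ^ m • ∑ p ∈ Finset.range (α + 1 - m),
      η i ^ p • lieCoeff (fun r => g r i) m p x)) fun m hm => ?_).trans
    (EqModPow.of_eq fun i x => ?_)
  · have hm' := Finset.mem_range.1 hm
    have h := ((eqModPow_lieOp_iterate hη hg α (n := α + 1 - m) (m := m) (by omega)
      (by omega)).pow_smul m).const_smul (ε ^ m / (m.factorial : ℝ))
    rw [Nat.add_sub_cancel' hm'.le] at h
    refine (EqModPow.of_eq fun i x => ?_).trans h
    rw [smul_smul]
    congr 1
    ring
  · have h := Finset.sum_range_diag_flip (α + 1) fun m p =>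
      (ε ^ m / (m.factorial : ℝ)) • (η i ^ (m + p) • lieCoeff (fun r => g r i) m p x)
    calc _ = _ := ?_
      _ = _ := h.symm
      _ = _ := ?_
    · refine Finset.sum_congr rfl fun m _ => ?_
      simp only [Finset.smul_sum, pow_add, mul_smul]
    · refine Finset.sum_congr rfl fun q _ => ?_
      rw [Finset.smul_sum]
      refine Finset.sum_congr rfl fun m hm => ?_
      have : m + (q - m) = q := by have := Finset.mem_range.1 hm; omega
      rw [this, smul_comm]

end Expansion

/-! ### The order conditions for the counter terms -/

section HeavyBall

variable {d : ℕ} {L : EuclideanSpace ℝ (Fin d) → ℝ} {μ : ℝ}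

theorem contDiff_gradient (hL : ContDiff ℝ ∞ L) : ContDiff ℝ ∞ (gradient L) :=
  (InnerProductSpace.toDual ℝ (EuclideanSpace ℝ (Fin d))).symm.contDiff.comp
    (hL.fderiv_right (m := ∞) (by simp))

theorem hbG_eq (hμ : μ ≠ 1) (k : ℕ) (x : EuclideanSpace ℝ (Fin d)) :
    hbG L μ k x = ((1 - μ ^ (k + 1)) / (1 - μ)) • gradient L x := by
  have h : 1 - μ ≠ 0 := sub_ne_zero.2 hμ.symm
  induction k with
  | zero => simp [hbG, div_self h]
  | succ k ih =>
    simp only [hbG]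
    rw [ih, smul_smul]
    nth_rewrite 2 [← one_smul ℝ (gradient L x)]
    rw [← add_smul]
    congr 1
    field_simp
    ring

theorem SmoothFamily.hbG (hL : ContDiff ℝ ∞ L) (h0 : 0 ≤ μ) (h1 : μ < 1) :
    SmoothFamily (hbG L μ) := by
  refine (SmoothFamily.term (fun k => (1 - μ ^ (k + 1)) / (1 - μ)) (1 / (1 - μ)) (fun k => ?_) _
    (contDiff_gradient hL)).congr fun k x => hbG_eq h1.ne k x
  have hk : μ ^ (k + 1) ≤ 1 := pow_le_one₀ h0 h1.le
  have hk0 : 0 ≤ μ ^ (k + 1) := pow_nonneg h0 _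
  have h : 0 < 1 - μ := sub_pos.2 h1
  rw [abs_of_nonneg (div_nonneg (sub_nonneg.2 hk) h.le)]
  exact div_le_div_of_nonneg_right (by linarith) h.le

theorem SmoothFamily.hbCoeff (hL : ContDiff ℝ ∞ L) (h0 : 0 ≤ μ) (h1 : μ < 1) (r : ℕ) :
    SmoothFamily (hbCoeff L μ r) := by
  induction r using Nat.strong_induction_on with
  | _ r ih =>
    cases r with
    | zero =>
      rw [_root_.hbCoeff]
      exact SmoothFamily.hbG hL h0 h1
    | succ σ =>
      rw [_root_.hbCoeff]
      refine (SmoothFamily.hbChi μ (fun r => ?_) σ).geomConv h0 h1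
      split_ifs with h
      · exact ih r h
      · exact SmoothFamily.zero

theorem hbCoeff_zero_eq (k : ℕ) (x : EuclideanSpace ℝ (Fin d)) :
    hbCoeff L μ 0 k x = μ • shiftSeq (hbCoeff L μ 0) k x + gradient L x := by
  cases k <;> simp [hbCoeff, shiftSeq, hbG]

/-- The geometric convolution unrolls this one-step recursion, which is the form the order
conditions use. -/
theorem hbCoeff_succ_eq (σ k : ℕ) (x : EuclideanSpace ℝ (Fin d)) :
    hbCoeff L μ (σ + 1) k x =
      μ • shiftSeq (hbCoeff L μ (σ + 1)) k x + hbChi μ (hbCoeff L μ) σ k x := by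
  rw [hbCoeff_succ, Finset.sum_range_succ]
  congr 1
  · cases k with
    | zero => simp [shiftSeq]
    | succ k =>
      rw [shiftSeq, hbCoeff_succ, Finset.smul_sum]
      refine Finset.sum_congr rfl fun j hj => ?_
      have : k + 1 - j = (k - j) + 1 := by have := Finset.mem_range.1 hj; omega
      rw [this, pow_succ', mul_smul]
  · simp

/-- The terms with `m ≥ 2` add up to `χ_k^{(q)}`, the `m = 1` terms give `-γ_k^{(q)} + μ
γ_{k-1}^{(q)}`, and the `m = 0` terms vanish. The recursion for the counter terms makes these
cancel. -/
theorem hb_order_condition (hL : ContDiff ℝ ∞ L) (h0 : 0 ≤ μ) (h1 : μ < 1) (k q : ℕ)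
    (x : EuclideanSpace ℝ (Fin d)) :
    ∑ m ∈ Finset.range (q + 2 + 1), ((-1 : ℝ) ^ m / (m.factorial : ℝ)) •
        lieCoeff (fun r => hbCoeff L μ r k) m (q + 2 - m) x
      + μ • ∑ m ∈ Finset.range (q + 2 + 1), ((1 : ℝ) ^ m / (m.factorial : ℝ)) •
        lieCoeff (fun r => shiftSeq (hbCoeff L μ r) k) m (q + 2 - m) x = 0 := by
  have hs (f : ℕ → EuclideanSpace ℝ (Fin d)) : ∑ m ∈ Finset.range (q + 2 + 1), f m =
      f 0 + f 1 + ∑ m ∈ Finset.Icc 2 (q + 2), f m := by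
    rw [Finset.range_eq_Ico, ← Finset.sum_Ico_consecutive f (Nat.zero_le 2) (by omega),
      ← Finset.range_eq_Ico, Finset.sum_range_succ, Finset.sum_range_one]
    rfl
  rw [hs, hs]
  have hχ := hbChi_eq_lieCoeff μ (SmoothFamily.hbCoeff hL h0 h1) q k x
  have hγ := hbCoeff_succ_eq (L := L) (μ := μ) q k x
  have e : q + 2 - 1 = q + 1 := by omega
  have hsum : ∑ m ∈ Finset.Icc 2 (q + 2), ((-1 : ℝ) ^ m / (m.factorial : ℝ)) •
        lieCoeff (fun r => hbCoeff L μ r k) m (q + 2 - m) x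
      + μ • ∑ m ∈ Finset.Icc 2 (q + 2), ((1 : ℝ) ^ m / (m.factorial : ℝ)) •
        lieCoeff (fun r => shiftSeq (hbCoeff L μ r) k) m (q + 2 - m) x
      = hbChi μ (hbCoeff L μ) q k x := by
    rw [hχ, Finset.smul_sum, ← Finset.sum_add_distrib]
    refine Finset.sum_congr rfl fun m _ => ?_
    rw [smul_add, smul_smul, smul_smul, smul_smul]
    congr 2
    · ring
    · rw [one_pow]; ring
  simp only [Nat.sub_zero, lieCoeff_one, e, lieCoeff_zero_succ, Pi.zero_apply, smul_zero, zero_add, pow_one,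
    Nat.factorial_one, Nat.cast_one, div_one, one_smul, neg_smul, smul_add]
  rw [add_add_add_comm, hsum, hγ]
  abel

theorem hb_lieTaylor (hL : ContDiff ℝ ∞ L) (h0 : 0 ≤ μ) (h1 : μ < 1) {α : ℕ} (hα : 1 ≤ α) :
    EqModPow (fun i : ℕ × Set.Icc (0 : ℝ) 1 => (i.2 : ℝ)) (α + 1)
      (fun i x =>
        lieTaylor (powField (fun r => hbCoeff L μ r i.1) α i.2) α (-1 * i.2) x
        + μ • lieTaylor (powField (fun r => shiftSeq (hbCoeff L μ r) i.1) α i.2) α (1 * i.2) x)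
      (fun i x => (1 + μ) • x - (i.2 : ℝ) • gradient L x) := by
  have hη (i : ℕ × Set.Icc (0 : ℝ) 1) : |(i.2 : ℝ)| ≤ 1 := by
    rw [abs_of_nonneg i.2.2.1]; exact i.2.2.2
  have hg := SmoothFamily.hbCoeff hL h0 h1
  refine ((eqModPow_lieTaylor hη (g := fun r i => hbCoeff L μ r i.1)
    (fun r => (hg r).reindex Prod.fst) α (-1)).add
    ((eqModPow_lieTaylor hη (g := fun r i => shiftSeq (hbCoeff L μ r) i.1)
    (fun r => (hg r).shiftSeq.reindex Prod.fst) α 1).const_smul μ)).trans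
    (EqModPow.of_eq fun i x => ?_)
  -- Degrees zero and one are split off: they produce `(1 + μ) x` and, by the recursion for `G_k`,
  -- `-η∇L`. All higher degrees vanish.
  obtain ⟨n, rfl⟩ := Nat.exists_eq_add_of_le' hα
  rw [Finset.smul_sum, ← Finset.sum_add_distrib, Finset.sum_range_succ', Finset.sum_range_succ',
    Finset.sum_eq_zero]
  · have h := hbCoeff_zero_eq (L := L) (μ := μ) i.1 x
    simp only [zero_add, Finset.sum_range_succ, Finset.sum_range_zero, lieCoeff_one,
      lieCoeff_zero_zero, lieCoeff_zero_succ (p := 0), Nat.sub_self, Nat.sub_zero, Pi.zero_apply, smul_zero, pow_zero, pow_one, one_pow,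
      Nat.factorial_one, Nat.factorial_zero, Nat.cast_one, div_one, one_smul, id, neg_smul]
    rw [h]
    module
  · intro q _
    rw [smul_comm μ, ← smul_add, hb_order_condition hL h0 h1, smul_zero]

end HeavyBall

/-! ### Taylor estimates for curves with one-sided derivatives -/

section Taylor

variable {E : Type*} [NormedAddCommGroup E] [NormedSpace ℝ E]

theorem norm_image_sub_le_of_norm_deriv_right_le {f f' : ℝ → E} {a b D : ℝ}
    (hf : ContinuousOn f (Set.Icc a b))
    (hf' : ∀ t ∈ Set.Ico a b, HasDerivWithinAt f (f' t) (Set.Ici t) t)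
    (hD : ∀ t ∈ Set.Ico a b, ‖f' t‖ ≤ D) (h0 : 0 ≤ D) {s t : ℝ} (hs : s ∈ Set.Icc a b)
    (ht : t ∈ Set.Icc a b) : ‖f t - f s‖ ≤ D * (b - a) := by
  wlog hst : s ≤ t generalizing s t
  · rw [norm_sub_rev]
    exact this ht hs (le_of_not_ge hst)
  have hsub : Set.Ico s t ⊆ Set.Ico a b := Set.Ico_subset_Ico hs.1 ht.2
  refine (norm_image_sub_le_of_norm_deriv_right_le_segment
    (hf.mono (Set.Icc_subset_Icc hs.1 ht.2)) (fun u hu => hf' u (hsub hu))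
    (fun u hu => hD u (hsub hu)) t (Set.right_mem_Icc.2 hst)).trans ?_
  exact mul_le_mul_of_nonneg_left (by linarith [hs.1, ht.2]) h0

/-- Induction on the order: the derivative of the remainder is the remainder one order lower, and
the mean value inequality supplies a factor `b - a`. The centre `c` may be the right endpoint, as
backward expansion requires. -/
theorem norm_sub_taylor_le {φ : ℕ → ℝ → E} {a b C : ℝ} {n : ℕ}
    (hcont : ∀ m < n, ContinuousOn (φ m) (Set.Icc a b))
    (hder : ∀ m < n, ∀ t ∈ Set.Ico a b, HasDerivWithinAt (φ m) (φ (m + 1) t) (Set.Ici t) t)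
    (hC : ∀ t ∈ Set.Icc a b, ‖φ n t‖ ≤ C) {c t : ℝ} (hc : c ∈ Set.Icc a b)
    (ht : t ∈ Set.Icc a b) :
    ‖φ 0 t - ∑ m ∈ Finset.range n, ((t - c) ^ m / (m.factorial : ℝ)) • φ m c‖
      ≤ C * (b - a) ^ n := by
  induction n generalizing φ t with
  | zero => simpa using hC t ht
  | succ n ih =>
    have hC0 : 0 ≤ C := (norm_nonneg _).trans (hC t ht)
    have hab : 0 ≤ b - a := by linarith [ht.1, ht.2]
    have hpoly (t : ℝ) : HasDerivAt
        (fun t => ∑ m ∈ Finset.range (n + 1), ((t - c) ^ m / (m.factorial : ℝ)) • φ m c)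
        (∑ m ∈ Finset.range n, ((t - c) ^ m / (m.factorial : ℝ)) • φ (m + 1) c) t := by
      simp only [Finset.sum_range_succ' _ n, pow_zero]
      refine (HasDerivAt.fun_sum fun m _ => ?_).add_const _
      refine HasDerivAt.smul_const ?_ _
      have h := (((hasDerivAt_id t).sub_const c).pow (m + 1)).div_const ((m + 1).factorial : ℝ)
      refine h.congr_deriv ?_
      rw [Nat.factorial_succ]
      have : (m.factorial : ℝ) ≠ 0 := by positivity
      push_cast
      simp only [id]
      field_simp
    have key := norm_image_sub_le_of_norm_deriv_right_le
      (f := fun t => φ 0 t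
        - ∑ m ∈ Finset.range (n + 1), ((t - c) ^ m / (m.factorial : ℝ)) • φ m c)
      (f' := fun t => φ 1 t
        - ∑ m ∈ Finset.range n, ((t - c) ^ m / (m.factorial : ℝ)) • φ (m + 1) c)
      (D := C * (b - a) ^ n)
      ((hcont 0 (by omega)).sub fun t _ => (hpoly t).continuousAt.continuousWithinAt)
      (fun t ht => (hder 0 (by omega) t ht).sub (hpoly t).hasDerivWithinAt)
      (fun t ht => ih (φ := fun m => φ (m + 1)) (fun m hm => hcont _ (by omega))
        (fun m hm => hder _ (by omega)) hC (Set.Ico_subset_Icc_self ht))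
      (by positivity) hc ht
    have hz : φ 0 c -
        ∑ m ∈ Finset.range (n + 1), ((c - c) ^ m / (m.factorial : ℝ)) • φ m c = 0 := by
      simp [Finset.sum_range_succ']
    rw [hz, sub_zero] at key
    rw [pow_succ, ← mul_assoc]
    exact key

theorem norm_sub_lieTaylor_le {F : E → E} (hF : ContDiff ℝ ∞ F) {φ : ℝ → E} {a b C : ℝ} {n : ℕ}
    (hcont : ContinuousOn φ (Set.Icc a b))
    (hder : ∀ t ∈ Set.Ico a b, HasDerivWithinAt φ (-F (φ t)) (Set.Ici t) t)
    (hC : ∀ t ∈ Set.Icc a b, ‖(lieOp F)^[n + 1] id (φ t)‖ ≤ C) {c t : ℝ} (hc : c ∈ Set.Icc a b)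
    (ht : t ∈ Set.Icc a b) :
    ‖φ t - lieTaylor F n (c - t) (φ c)‖ ≤ C * (b - a) ^ (n + 1) := by
  have hsm (m : ℕ) : ContDiff ℝ ∞ ((lieOp F)^[m] id) :=
    ((SmoothFamily.const (ι := Unit) hF).lieOp_iterate m).contDiff ()
  have h := norm_sub_taylor_le (φ := fun m t => (-1 : ℝ) ^ m • (lieOp F)^[m] id (φ t))
    (a := a) (b := b) (C := C) (n := n + 1)
    (fun m _ => ((hsm m).continuous.comp_continuousOn hcont).const_smul _)
    (fun m _ t ht => by
      have h1 := (((hsm m).differentiable (by simp) (φ t)).hasFDerivAt.comp_hasDerivWithinAt t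
        (hder t ht)).const_smul ((-1 : ℝ) ^ m)
      refine h1.congr_deriv ?_
      rw [Function.iterate_succ_apply', map_neg, pow_succ]
      simp [lieOp])
    (fun t ht => by simpa [norm_smul] using hC t ht) hc ht
  refine le_trans (le_of_eq ?_) h
  simp only [pow_zero, one_smul, Function.iterate_zero, id, lieTaylor]
  congr 2
  refine Finset.sum_congr rfl fun m _ => ?_
  rw [smul_smul]
  congr 1
  rw [show c - t = (t - c) * (-1) by ring, mul_pow]
  ring

end Taylor

/-! ### A discrete Gronwall inequality with momentum -/

section Gronwall

/-- The quantity `a k + μ/(1-μ) * δ k` absorbs the momentum: its weight is reproduced by one step,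
leaving growth by `1 + K'η` and a source `c'η^(α+1)`. The recursion is assumed only while `a k ≤ 1`,
because the gradient is only locally Lipschitz; the bound being proved keeps this condition alive.
-/
theorem momentum_gronwall {μ : ℝ} (h0 : 0 ≤ μ) (h1 : μ < 1) {K c T : ℝ} (hK : 0 ≤ K) (hc : 0 ≤ c)
    (hT : 0 ≤ T) {α : ℕ} (hα : 1 ≤ α) : ∃ C η₀ : ℝ, 0 < η₀ ∧ η₀ ≤ 1 ∧
      ∀ η : ℝ, 0 < η → η ≤ η₀ → ∀ N : ℕ, N * η ≤ T → ∀ a δ : ℕ → ℝ,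
        (∀ k, 0 ≤ a k) → (∀ k, 0 ≤ δ k) → a 0 = 0 → δ 0 = 0 →
        (∀ k, a (k + 1) ≤ a k + δ (k + 1)) →
        (∀ k < N, a k ≤ 1 → δ (k + 1) ≤ μ * δ k + η * K * a k + c * η ^ (α + 1)) →
        (∀ k < N, δ (k + 1) ≤ C * η ^ (α + 1)) ∧ ∀ k ≤ N, a k ≤ C * η ^ α := by
  have hμ : 0 < 1 - μ := sub_pos.2 h1
  obtain ⟨c', hc'⟩ : ∃ c', c' = c / (1 - μ) := ⟨_, rfl⟩
  obtain ⟨K', hK'⟩ : ∃ K', K' = K / (1 - μ) := ⟨_, rfl⟩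
  have hc'0 : 0 ≤ c' := hc' ▸ by positivity
  have hK'0 : 0 ≤ K' := hK' ▸ by positivity
  obtain ⟨B, hB⟩ : ∃ B, B = T * c' * Real.exp (K' * T) := ⟨_, rfl⟩
  have hB0 : 0 ≤ B := hB ▸ by positivity
  -- `D` is the fixed point of `x ↦ μ x + K B + c`, so the increment bound propagates unchanged.
  obtain ⟨D, hD⟩ : ∃ D, D = (K * B + c) / (1 - μ) := ⟨_, rfl⟩
  have hD0 : 0 ≤ D := hD ▸ by positivity
  have hDeq : μ * D + K * B + c = D := by rw [hD]; field_simp; ring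
  refine ⟨B + D, 1 / (B + 1), by positivity, ?_, ?_⟩
  · rw [div_le_one (by positivity)]; linarith
  intro η hη hη₀ N hN a δ ha hδ ha0 hδ0 hstep hrec
  have hη1 : η ≤ 1 := hη₀.trans (by rw [div_le_one (by positivity)]; linarith)
  have hBη : B * η ^ α ≤ 1 := by
    calc B * η ^ α ≤ B * η := mul_le_mul_of_nonneg_left
          ((pow_le_pow_of_le_one hη.le hη1 hα).trans (pow_one η).le) hB0
      _ ≤ (B + 1) * η := by nlinarith
      _ ≤ (B + 1) * (1 / (B + 1)) := mul_le_mul_of_nonneg_left hη₀ (by positivity)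
      _ = 1 := by field_simp
  have hkB (k : ℕ) (hk : k ≤ N) :
      k * η * c' * η ^ α * Real.exp (K' * (k * η)) ≤ B * η ^ α := by
    have hkT : k * η ≤ T :=
      (mul_le_mul_of_nonneg_right (Nat.cast_le.2 hk) hη.le).trans hN
    calc k * η * c' * η ^ α * Real.exp (K' * (k * η))
        ≤ T * c' * η ^ α * Real.exp (K' * T) := by gcongr
      _ = B * η ^ α := by rw [hB]; ring
  have hW (k : ℕ) (hk : k ≤ N) :
      a k + μ / (1 - μ) * δ k ≤ k * η * c' * η ^ α * Real.exp (K' * (k * η)) := by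
    induction k with
    | zero => simp [ha0, hδ0]
    | succ k ih =>
      have ihk := ih (by omega)
      have hpos : 0 ≤ μ / (1 - μ) * δ k := mul_nonneg (by positivity) (hδ k)
      have hak : a k ≤ 1 := by linarith [hkB k (by omega)]
      have hr := hrec k (by omega) hak
      set e := Real.exp (K' * (k * η)) with he
      have hexp : Real.exp (K' * ((k + 1 : ℕ) * η)) = e * Real.exp (K' * η) := by
        rw [he, ← Real.exp_add]; push_cast; ring_nf
      have he1 : 1 + K' * η ≤ Real.exp (K' * η) := by
        linarith [Real.add_one_le_exp (K' * η)]
      have hee : 1 ≤ e * Real.exp (K' * η) := by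
        rw [← hexp]; exact Real.one_le_exp (by positivity)
      have hmain : a (k + 1) + μ / (1 - μ) * δ (k + 1)
          ≤ (a k + μ / (1 - μ) * δ k) * (1 + K' * η) + c' * η ^ (α + 1) := by
        calc a (k + 1) + μ / (1 - μ) * δ (k + 1)
            ≤ a k + δ (k + 1) + μ / (1 - μ) * δ (k + 1) := by linarith [hstep k]
          _ = a k + δ (k + 1) / (1 - μ) := by field_simp; ring
          _ ≤ a k + (μ * δ k + η * K * a k + c * η ^ (α + 1)) / (1 - μ) := by gcongr
          _ = a k + μ / (1 - μ) * δ k + K' * η * a k + c' * η ^ (α + 1) := by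
              rw [hK', hc']; field_simp; ring
          _ ≤ _ := by nlinarith [mul_nonneg (mul_nonneg hK'0 hη.le) hpos]
      refine hmain.trans ?_
      rw [hexp]
      have hp : 0 ≤ k * η * c' * η ^ α * e := by positivity
      have hq : 0 ≤ c' * η ^ (α + 1) := by positivity
      calc (a k + μ / (1 - μ) * δ k) * (1 + K' * η) + c' * η ^ (α + 1)
          ≤ (k * η * c' * η ^ α * e) * Real.exp (K' * η)
            + c' * η ^ (α + 1) * (e * Real.exp (K' * η)) := by
            refine add_le_add (mul_le_mul ihk he1 (by positivity) hp) ?_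
            exact le_mul_of_one_le_right hq hee
        _ = _ := by push_cast; ring
  have haB (k : ℕ) (hk : k ≤ N) : a k ≤ B * η ^ α := by
    have := mul_nonneg (by positivity : 0 ≤ μ / (1 - μ)) (hδ k)
    linarith [hW k hk, hkB k hk]
  have hδD (k : ℕ) (hk : k ≤ N) : δ k ≤ D * η ^ (α + 1) := by
    induction k with
    | zero => rw [hδ0]; positivity
    | succ k ih =>
      calc δ (k + 1) ≤ μ * δ k + η * K * a k + c * η ^ (α + 1) :=
            hrec k (by omega) ((haB k (by omega)).trans hBη)
        _ ≤ μ * (D * η ^ (α + 1)) + η * K * (B * η ^ α) + c * η ^ (α + 1) := by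
            gcongr
            · exact ih (by omega)
            · exact haB k (by omega)
        _ = (μ * D + K * B + c) * η ^ (α + 1) := by ring
        _ = _ := by rw [hDeq]
  refine ⟨fun k hk => (hδD (k + 1) hk).trans ?_, fun k hk => (haB k hk).trans ?_⟩
  · exact mul_le_mul_of_nonneg_right (by linarith) (by positivity)
  · exact mul_le_mul_of_nonneg_right (by linarith) (by positivity)

end Gronwall

/-! ### From local to global error along the flow -/

section Flow

variable {d : ℕ} {L : EuclideanSpace ℝ (Fin d) → ℝ} {μ : ℝ} {α N : ℕ} {η : ℝ}
  {β₀ : EuclideanSpace ℝ (Fin d)} {β : ℝ → EuclideanSpace ℝ (Fin d)}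

theorem hbG_add_smul_hbGamma (hα : 1 ≤ α) (k : ℕ) (x : EuclideanSpace ℝ (Fin d)) :
    -hbG L μ k x - η • hbGamma L μ α η k x = -powField (fun r => hbCoeff L μ r k) α η x := by
  obtain ⟨n, rfl⟩ := Nat.exists_eq_add_of_le' hα
  rw [powField, Finset.sum_range_succ', hbGamma, Finset.smul_sum, Nat.add_sub_cancel, neg_add,
    add_comm, sub_eq_add_neg]
  congr 1
  · simp [hbCoeff]
  · simp only [smul_smul, pow_succ']

/-- Truncated subtraction at `k = 0` encodes `β_{-1} = β_0`, so one formula covers all steps. -/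
theorem hbIter_succ (k : ℕ) :
    hbIter L μ η β₀ (k + 1) = hbIter L μ η β₀ k - η • gradient L (hbIter L μ η β₀ k)
      + μ • (hbIter L μ η β₀ k - hbIter L μ η β₀ (k - 1)) := by
  cases k with
  | zero => simp [hbIter]
  | succ k => rfl

theorem IsHBFlow.hasDerivWithinAt_Ici (hα : 1 ≤ α) (hβ : IsHBFlow L μ α η N β₀ β) {k : ℕ}
    (hk : k < N) {t : ℝ} (ht : t ∈ Set.Ico (k * η) ((k + 1) * η)) :
    HasDerivWithinAt β (-powField (fun r => hbCoeff L μ r k) α η (β t)) (Set.Ici t) t := by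
  rw [← hbG_add_smul_hbGamma hα]
  exact (hβ.deriv k hk t ht).mono_of_mem_nhdsWithin (Ico_mem_nhdsGE_of_mem ht)

theorem IsHBFlow.continuousOn_piece (hβ : IsHBFlow L μ α η N β₀ β) (hη : 0 < η) {k : ℕ}
    (hk : k < N) : ContinuousOn β (Set.Icc (k * η) ((k + 1) * η)) := by
  refine hβ.cont.mono (Set.Icc_subset_Icc (by positivity) ?_)
  exact mul_le_mul_of_nonneg_right (by exact_mod_cast hk) hη.le

/-- The flow satisfies the heavy-ball recursion up to an error of order `η ^ (α + 1)`. -/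
theorem exists_local_error_bound (hL : ContDiff ℝ ∞ L) (h0 : 0 ≤ μ) (h1 : μ < 1) (hα : 1 ≤ α)
    (R : ℝ) : ∃ c, 0 ≤ c ∧ ∀ η : ℝ, 0 < η → η ≤ 1 → ∀ (N : ℕ) (β₀ : EuclideanSpace ℝ (Fin d))
      (β : ℝ → EuclideanSpace ℝ (Fin d)), IsHBFlow L μ α η N β₀ β →
      (∀ t ∈ Set.Icc 0 (N * η), ‖β t‖ ≤ R) → ∀ k < N,
      ‖β ((k + 1 : ℕ) * η) + μ • β ((k - 1 : ℕ) * η)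
        - ((1 + μ) • β (k * η) - η • gradient L (β (k * η)))‖ ≤ c * η ^ (α + 1) := by
  have hη' (i : ℕ × Set.Icc (0 : ℝ) 1) : |(i.2 : ℝ)| ≤ 1 := by
    rw [abs_of_nonneg i.2.2.1]; exact i.2.2.2
  have hg := SmoothFamily.hbCoeff hL h0 h1
  have hF := SmoothFamily.powField hη' (g := fun r i => hbCoeff L μ r i.1)
    (fun r => (hg r).reindex Prod.fst) α
  have hF' := SmoothFamily.powField hη' (g := fun r i => shiftSeq (hbCoeff L μ r) i.1)
    (fun r => (hg r).shiftSeq.reindex Prod.fst) α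
  obtain ⟨C₁, hC₁0, hC₁⟩ := (hF.lieOp_iterate (α + 1)).exists_bound R
  obtain ⟨C₂, hC₂0, hC₂⟩ := (hF'.lieOp_iterate (α + 1)).exists_bound R
  obtain ⟨ρ, hρ, hT⟩ := hb_lieTaylor hL h0 h1 hα
  obtain ⟨C₃, hC₃0, hC₃⟩ := hρ.exists_bound R
  refine ⟨C₁ + μ * C₂ + C₃, by positivity, fun η hη hη1 N β₀ β hβ hR k hk => ?_⟩
  have hR' (j : ℕ) (hj : j < N) (t : ℝ) (ht : t ∈ Set.Icc (j * η) ((j + 1) * η)) :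
      ‖β t‖ ≤ R := by
    have hjN : (j + 1 : ℝ) * η ≤ N * η := mul_le_mul_of_nonneg_right (by exact_mod_cast hj) hη.le
    exact hR t ⟨le_trans (by positivity) ht.1, ht.2.trans hjN⟩
  obtain ⟨i, hi⟩ : ∃ i : ℕ × Set.Icc (0 : ℝ) 1, i = (k, ⟨η, hη.le, hη1⟩) := ⟨_, rfl⟩
  have hi1 : i.1 = k := by rw [hi]
  have hi2 : (i.2 : ℝ) = η := by rw [hi]
  have hle (j : ℕ) : (j : ℝ) * η ≤ (j + 1) * η := by nlinarith
  have hforward : ‖β ((k + 1 : ℕ) * η)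
      - lieTaylor (powField (fun r => hbCoeff L μ r k) α η) α (-1 * η) (β (k * η))‖
      ≤ C₁ * η ^ (α + 1) := by
    have h := norm_sub_lieTaylor_le (F := powField (fun r => hbCoeff L μ r k) α η) (φ := β)
      (n := α) (C := C₁) (a := k * η) (b := (k + 1) * η) (c := k * η) (t := (k + 1) * η)
      (by simpa [hi] using hF.contDiff i)
      (hβ.continuousOn_piece hη hk) (fun t ht => hβ.hasDerivWithinAt_Ici hα hk ht)
      (fun t ht => by simpa [hi] using hC₁ i (β t) (hR' k hk t ht))
      (Set.left_mem_Icc.2 (hle k)) (Set.right_mem_Icc.2 (hle k))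
    rw [show (k : ℝ) * η - (k + 1) * η = -1 * η by ring,
      show ((k : ℝ) + 1) * η - k * η = η by ring] at h
    exact_mod_cast h
  have hbackward : ‖β ((k - 1 : ℕ) * η)
      - lieTaylor (powField (fun r => shiftSeq (hbCoeff L μ r) k) α η) α (1 * η) (β (k * η))‖
      ≤ C₂ * η ^ (α + 1) := by
    have hsm : ContDiff ℝ ∞ (powField (fun r => shiftSeq (hbCoeff L μ r) k) α η) := by
      simpa [hi] using hF'.contDiff i
    cases k with
    -- The field with index `-1` is zero, so the backward flow from `β_0` is constant and agrees
    -- with `β_{-1} = β_0`.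
    | zero =>
      have h := norm_sub_lieTaylor_le hsm (φ := fun _ => β 0)
        (n := α) (C := C₂) (a := 0) (b := η) (c := η) (t := 0) continuousOn_const
        (fun t _ => by simpa [powField, shiftSeq] using hasDerivWithinAt_const t _ (β 0))
        (fun t ht => by
          simpa [hi] using hC₂ i (β 0) (hR' 0 hk 0 ⟨by simp, by positivity⟩))
        (Set.right_mem_Icc.2 hη.le) (Set.left_mem_Icc.2 hη.le)
      simpa using h
    | succ k =>
      have h := norm_sub_lieTaylor_le hsm (φ := β)
        (n := α) (C := C₂) (a := k * η) (b := (k + 1) * η) (c := (k + 1) * η) (t := k * η)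
        (hβ.continuousOn_piece hη (by omega))
        (fun t ht => hβ.hasDerivWithinAt_Ici hα (by omega) ht)
        (fun t ht => by simpa [hi] using hC₂ i (β t) (hR' k (by omega) t ht))
        (Set.right_mem_Icc.2 (hle k)) (Set.left_mem_Icc.2 (hle k))
      rw [show ((k : ℝ) + 1) * η - k * η = 1 * η by ring] at h
      simpa using h
  have hres := hT i (β (k * η))
  simp only [hi1, hi2] at hres
  have hρk : ‖η ^ (α + 1) • ρ i (β (k * η))‖ ≤ C₃ * η ^ (α + 1) := by
    rw [norm_smul, Real.norm_of_nonneg (by positivity), mul_comm]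
    exact mul_le_mul_of_nonneg_right (hC₃ i _ (hR' k hk _ (Set.left_mem_Icc.2 (hle k))))
      (by positivity)
  rw [eq_sub_of_add_eq hres.symm]
  calc _ = ‖(β ((k + 1 : ℕ) * η)
        - lieTaylor (powField (fun r => hbCoeff L μ r k) α η) α (-1 * η) (β (k * η)))
        + μ • (β ((k - 1 : ℕ) * η)
        - lieTaylor (powField (fun r => shiftSeq (hbCoeff L μ r) k) α η) α (1 * η) (β (k * η)))
        + η ^ (α + 1) • ρ i (β (k * η))‖ := by
        congr 1
        module
    _ ≤ C₁ * η ^ (α + 1) + μ * (C₂ * η ^ (α + 1)) + C₃ * η ^ (α + 1) := by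
        refine (norm_add₃_le).trans (add_le_add (add_le_add hforward ?_) hρk)
        rw [norm_smul, Real.norm_of_nonneg h0]
        exact mul_le_mul_of_nonneg_left hbackward h0
    _ = _ := by ring

theorem exists_error_bound_of_norm_le (hL : ContDiff ℝ ∞ L) (h0 : 0 ≤ μ) (h1 : μ < 1)
    (hα : 1 ≤ α) (R T : ℝ) : ∃ C η₀ : ℝ, 0 < η₀ ∧ η₀ ≤ 1 ∧
      ∀ η : ℝ, 0 < η → η ≤ η₀ → ∀ N : ℕ, N * η ≤ T →
        ∀ β₀ β, IsHBFlow L μ α η N β₀ β → (∀ t ∈ Set.Icc 0 (N * η), ‖β t‖ ≤ R) →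
          (∀ k < N, ‖discErr L μ η β₀ β (k + 1) - discErr L μ η β₀ β k‖ ≤ C * η ^ (α + 1)) ∧
          (∀ k ≤ N, ‖discErr L μ η β₀ β k‖ ≤ C * η ^ α) := by
  obtain ⟨c, hc, hloc⟩ := exists_local_error_bound hL h0 h1 hα R
  obtain ⟨K, hK, hlip⟩ :=
    -- While the error is at most one, the iterates stay within radius `R + 1`.
    (SmoothFamily.const (ι := Unit) (contDiff_gradient hL)).exists_lipschitz (R + 1)
  obtain ⟨C, η₀, hη₀, hη₀1, hgr⟩ := momentum_gronwall h0 h1 hK hc (le_max_right T 0) hα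
  refine ⟨C, η₀, hη₀, hη₀1, fun η hη hηη₀ N hN β₀ β hβ hR => ?_⟩
  have hη1 := hηη₀.trans hη₀1
  set e := discErr L μ η β₀ β with he
  refine hgr η hη hηη₀ N (hN.trans (le_max_left _ _)) (fun k => ‖e k‖)
    (fun k => ‖e k - e (k - 1)‖) (fun _ => norm_nonneg _) (fun _ => norm_nonneg _)
    (by simp [he, discErr, hbIter, hβ.1]) (by simp) (fun k => ?_) fun k hk hek => ?_
  · simpa using norm_add_le (e k) (e (k + 1) - e k)
  · have hmem : (k : ℝ) * η ∈ Set.Icc 0 (N * η) :=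
      ⟨by positivity, mul_le_mul_of_nonneg_right (by exact_mod_cast hk.le) hη.le⟩
    have hbk := hR _ hmem
    have hxk : ‖hbIter L μ η β₀ k‖ ≤ R + 1 := by
      have : hbIter L μ η β₀ k = β (k * η) - e k := by simp [he, discErr]
      rw [this]
      exact (norm_sub_le _ _).trans (add_le_add hbk hek)
    have hl : ‖gradient L (β (k * η)) - gradient L (hbIter L μ η β₀ k)‖ ≤ K * ‖e k‖ :=
      hlip () _ _ (by linarith) hxk
    have hrec : e (k + 1) - e k = μ • (e k - e (k - 1))
        - η • (gradient L (β (k * η)) - gradient L (hbIter L μ η β₀ k))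
        + (β ((k + 1 : ℕ) * η) + μ • β ((k - 1 : ℕ) * η)
        - ((1 + μ) • β (k * η) - η • gradient L (β (k * η)))) := by
      simp only [he, discErr, hbIter_succ]
      module
    rw [Nat.add_sub_cancel, hrec]
    refine (norm_add_le _ _).trans (add_le_add ((norm_sub_le _ _).trans (add_le_add ?_ ?_))
      (hloc η hη hη1 N β₀ β hβ hR k hk))
    · rw [norm_smul, Real.norm_of_nonneg h0]
    · rw [norm_smul, Real.norm_of_nonneg hη.le, mul_assoc]
      exact mul_le_mul_of_nonneg_left hl hη.le

/-! ### Confinement and existence of the flow -/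

/-- A barrier argument: wherever the distance equals `M t`, `hN` puts the point in the ball where
the speed is strictly below `M`, so the barrier cannot be crossed. -/
theorem IsHBFlow.norm_sub_le (hα : 1 ≤ α) (hη : 0 < η) (hβ : IsHBFlow L μ α η N β₀ β) {M : ℝ}
    (hM : ∀ k x, ‖x‖ ≤ ‖β₀‖ + 1 → ‖powField (fun r => hbCoeff L μ r k) α η x‖ < M)
    (hN : M * (N * η) ≤ 1) {t : ℝ} (ht : t ∈ Set.Icc 0 (N * η)) : ‖β t - β₀‖ ≤ M * t := by
  have hM0 : 0 < M := (norm_nonneg _).trans_lt (hM 0 β₀ (by linarith))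
  refine image_norm_le_of_norm_deriv_right_lt_deriv_boundary' (f := fun t => β t - β₀)
    (f' := fun t => -powField (fun r => hbCoeff L μ r ⌊t / η⌋₊) α η (β t))
    (B := fun t => M * t) (B' := fun _ => M) (hβ.cont.sub continuousOn_const)
    (fun s hs => ?_) (by simp [hβ.1]) (by fun_prop)
    (fun s _ => by simpa using ((hasDerivWithinAt_id s (Set.Ici s)).const_mul M))
    (fun s hs hse => ?_) ht
  · have hk : ⌊s / η⌋₊ < N := by
      rw [Nat.floor_lt (div_nonneg hs.1 hη.le), div_lt_iff₀ hη]
      exact hs.2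
    refine (hβ.hasDerivWithinAt_Ici hα hk ⟨?_, ?_⟩).sub_const β₀
    · rw [← le_div_iff₀ hη]
      exact Nat.floor_le (div_nonneg hs.1 hη.le)
    · rw [← div_lt_iff₀ hη]
      exact Nat.lt_floor_add_one _
  · rw [norm_neg]
    refine hM _ _ ?_
    have h1 : ‖β s - β₀‖ ≤ 1 := by
      rw [hse]
      exact (mul_le_mul_of_nonneg_left hs.2.le hM0.le).trans hN
    calc ‖β s‖ = ‖β₀ + (β s - β₀)‖ := by congr 1; abel
      _ ≤ ‖β₀‖ + 1 := (norm_add_le _ _).trans (by linarith)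

/-- Picard–Lindelöf runs on a ball of radius `M η` about the current endpoint. By `hN` it lies in
the region with speed bound `M`, so the solution lasts a full step and is glued on. -/
theorem IsHBFlow.exists_succ (hL : ContDiff ℝ ∞ L) (h0 : 0 ≤ μ) (h1 : μ < 1) (hα : 1 ≤ α)
    (hη : 0 < η) (hβ : IsHBFlow L μ α η N β₀ β) {M : ℝ}
    (hM : ∀ k x, ‖x‖ ≤ ‖β₀‖ + 1 → ‖powField (fun r => hbCoeff L μ r k) α η x‖ < M)
    (hN : M * ((N + 1 : ℕ) * η) ≤ 1) : ∃ β', IsHBFlow L μ α η (N + 1) β₀ β' := by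
  have hM0 : 0 < M := (norm_nonneg _).trans_lt (hM 0 β₀ (by linarith))
  push_cast at hN
  have hNη : (0 : ℝ) ≤ N * η := by positivity
  have hle : (N : ℝ) * η ≤ (N + 1) * η := by nlinarith
  have hx : ‖β (N * η) - β₀‖ ≤ M * (N * η) :=
    hβ.norm_sub_le hα hη hM ((mul_le_mul_of_nonneg_left hle hM0.le).trans hN)
      (Set.right_mem_Icc.2 hNη)
  have hball (y : EuclideanSpace ℝ (Fin d)) (hy : y ∈ Metric.closedBall (β (N * η)) (M * η)) :
      ‖y‖ ≤ ‖β₀‖ + 1 := by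
    rw [mem_closedBall_iff_norm] at hy
    calc ‖y‖ = ‖β₀ + (β (N * η) - β₀) + (y - β (N * η))‖ := by congr 1; abel
      _ ≤ ‖β₀‖ + M * (N * η) + M * η :=
          (norm_add₃_le).trans (add_le_add (add_le_add le_rfl hx) hy)
      _ ≤ ‖β₀‖ + 1 := by linarith
  have hsm : SmoothFamily fun _ : Unit => powField (fun r => hbCoeff L μ r N) α η :=
    SmoothFamily.const <| ContDiff.sum fun r _ =>
      ((SmoothFamily.hbCoeff hL h0 h1 r).contDiff N).const_smul (η ^ r)
  obtain ⟨K, hK, hlip⟩ := hsm.exists_lipschitz (‖β₀‖ + 1)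
  have hPL : IsPicardLindelof (fun _ x => -powField (fun r => hbCoeff L μ r N) α η x)
      (tmin := N * η) (tmax := (N + 1) * η) ⟨N * η, Set.left_mem_Icc.2 hle⟩ (β (N * η))
      ⟨M * η, by positivity⟩ 0 ⟨M, hM0.le⟩ ⟨K, hK⟩ := by
    refine IsPicardLindelof.of_time_independent (fun y hy => ?_)
      (LipschitzOnWith.of_dist_le_mul fun y hy z hz => ?_) ?_
    · rw [norm_neg]
      exact (hM N y (hball y hy)).le
    · rw [dist_neg_neg, dist_eq_norm, dist_eq_norm]
      exact hlip () y z (hball y hy) (hball z hz)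
    · have : ((N : ℝ) + 1) * η - N * η = η := by ring
      simp only [this, sub_self, max_eq_left hη.le, NNReal.coe_zero, sub_zero]
      exact le_rfl
  obtain ⟨ψ, hψ0, hψ⟩ := hPL.exists_eq_forall_mem_Icc_hasDerivWithinAt₀
  simp only at hψ0
  classical
  obtain ⟨β', hβ'⟩ : ∃ β' : ℝ → EuclideanSpace ℝ (Fin d),
      β' = fun t => if t ≤ N * η then β t else ψ t := ⟨_, rfl⟩
  have hleft (t : ℝ) (ht : t ≤ N * η) : β' t = β t := by simp [hβ', ht]
  have hright (t : ℝ) (ht : N * η ≤ t) : β' t = ψ t := by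
    rcases ht.eq_or_lt with rfl | ht
    · rw [hleft _ le_rfl, hψ0]
    · simp [hβ', not_le.2 ht]
  refine ⟨β', ?_, ?_, fun k hk t ht => ?_⟩
  · rw [hleft 0 hNη, hβ.1]
  · push_cast
    rw [← Set.Icc_union_Icc_eq_Icc hNη hle]
    exact (hβ.cont.congr fun t ht => hleft t ht.2).union_of_isClosed
      (ContinuousOn.congr (fun t ht => (hψ t ht).continuousWithinAt) fun t ht => hright t ht.1)
      isClosed_Icc isClosed_Icc
  · rcases (Nat.lt_succ_iff.1 hk).eq_or_lt with rfl | hk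
    · rw [hright t ht.1, hbG_add_smul_hbGamma hα]
      exact ((hψ t (Set.Ico_subset_Icc_self ht)).mono Set.Ico_subset_Icc_self).congr
        (fun s hs => hright s hs.1) (hright t ht.1)
    · have hkN : (k + 1 : ℝ) * η ≤ N * η :=
        mul_le_mul_of_nonneg_right (by exact_mod_cast hk) hη.le
      rw [hleft t (ht.2.le.trans hkN)]
      exact (hβ.deriv k hk t ht).congr (fun s hs => hleft s (hs.2.le.trans hkN))
        (hleft t (ht.2.le.trans hkN))

theorem exists_isHBFlow (hL : ContDiff ℝ ∞ L) (h0 : 0 ≤ μ) (h1 : μ < 1) (hα : 1 ≤ α)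
    (hη : 0 < η) {M : ℝ}
    (hM : ∀ k x, ‖x‖ ≤ ‖β₀‖ + 1 → ‖powField (fun r => hbCoeff L μ r k) α η x‖ < M)
    (hN : M * (N * η) ≤ 1) : ∃ β, IsHBFlow L μ α η N β₀ β := by
  induction N with
  | zero =>
    exact ⟨fun _ => β₀, rfl, continuousOn_const, fun k hk => absurd hk (Nat.not_lt_zero k)⟩
  | succ N ih =>
    have hM0 : 0 < M := (norm_nonneg _).trans_lt (hM 0 β₀ (by linarith))
    obtain ⟨β, hβ⟩ := ih (le_trans (by gcongr; simp) hN)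
    exact hβ.exists_succ hL h0 h1 hα hη hM hN

end Flow
theorem theorem1 {d : ℕ} (L : EuclideanSpace ℝ (Fin d) → ℝ) (hL : ContDiff ℝ ∞ L)
    (μ : ℝ) (hμ : μ ∈ Set.Ioo (0 : ℝ) 1) (α : ℕ) (hα : 1 ≤ α) :
    -- closed form of `G_k`
    (∀ (k : ℕ) (x : EuclideanSpace ℝ (Fin d)),
      hbG L μ k x = ((1 - μ ^ (k + 1)) / (1 - μ)) • gradient L x) ∧
    -- a fixed number `N` of iterations, `η → 0`: the flow exists and the estimates hold
    (∀ (β₀ : EuclideanSpace ℝ (Fin d)) (N : ℕ), ∃ C η₀ : ℝ, 0 < η₀ ∧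
      ∀ η : ℝ, 0 < η → η ≤ η₀ →
        (∃ β, IsHBFlow L μ α η N β₀ β) ∧
        ∀ β, IsHBFlow L μ α η N β₀ β →
          (∀ k < N, ‖discErr L μ η β₀ β (k + 1) - discErr L μ η β₀ β k‖ ≤ C * η ^ (α + 1)) ∧
          (∀ k ≤ N, ‖discErr L μ η β₀ β k‖ ≤ C * η ^ α)) ∧
    -- a fixed time horizon `T`, so up to `T / η` iterations: the same estimates hold, with
    -- constants that do not depend on `N` or `β₀`, for flows that stay in a fixed ball
    (∀ R T : ℝ, ∃ C η₀ : ℝ, 0 < η₀ ∧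
      ∀ η : ℝ, 0 < η → η ≤ η₀ → ∀ N : ℕ, N * η ≤ T →
        ∀ β₀ β, IsHBFlow L μ α η N β₀ β → (∀ t ∈ Set.Icc 0 (N * η), ‖β t‖ ≤ R) →
          (∀ k < N, ‖discErr L μ η β₀ β (k + 1) - discErr L μ η β₀ β k‖ ≤ C * η ^ (α + 1)) ∧
          (∀ k ≤ N, ‖discErr L μ η β₀ β k‖ ≤ C * η ^ α)) := by
  obtain ⟨h0, h1⟩ := hμ
  refine ⟨fun k x => hbG_eq h1.ne k x, fun β₀ N => ?_, fun R T => ?_⟩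
  · have hη' (i : ℕ × Set.Icc (0 : ℝ) 1) : |(i.2 : ℝ)| ≤ 1 := by
      rw [abs_of_nonneg i.2.2.1]; exact i.2.2.2
    obtain ⟨B, hB0, hB⟩ := (SmoothFamily.powField hη' (g := fun r i => hbCoeff L μ r i.1)
      (fun r => (SmoothFamily.hbCoeff hL h0.le h1 r).reindex Prod.fst) α).exists_bound (‖β₀‖ + 1)
    obtain ⟨C, η₀, hη₀, hη₀1, h⟩ :=
      exists_error_bound_of_norm_le hL h0.le h1 hα (‖β₀‖ + 1) (N : ℝ)
    -- The second bound ensures `(B + 1) * (N * η) ≤ 1`, so that travel at speed `B + 1` stays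
    -- within distance one of `β₀`.
    refine ⟨C, min η₀ (1 / ((B + 1) * (N + 1))), by positivity, fun η hη hηη₀ => ?_⟩
    have hη1 : η ≤ 1 := (hηη₀.trans (min_le_left _ _)).trans hη₀1
    have hM (k : ℕ) (x : EuclideanSpace ℝ (Fin d)) (hx : ‖x‖ ≤ ‖β₀‖ + 1) :
        ‖powField (fun r => hbCoeff L μ r k) α η x‖ < B + 1 :=
      (hB (k, ⟨η, hη.le, hη1⟩) x hx).trans_lt (lt_add_one B)
    have hN : (B + 1) * (N * η) ≤ 1 := by
      have := (le_div_iff₀ (by positivity)).1 (hηη₀.trans (min_le_right _ _))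
      nlinarith
    refine ⟨exists_isHBFlow hL h0.le h1 hα hη hM hN, fun β hβ => ?_⟩
    refine h η hη (hηη₀.trans (min_le_left _ _)) N
      (mul_le_of_le_one_right (Nat.cast_nonneg N) hη1) β₀ β hβ fun t ht => ?_
    have ht' := hβ.norm_sub_le hα hη hM hN ht
    have : (B + 1) * t ≤ 1 := (mul_le_mul_of_nonneg_left ht.2 (by positivity)).trans hN
    calc ‖β t‖ = ‖β₀ + (β t - β₀)‖ := by congr 1; abel
      _ ≤ ‖β₀‖ + 1 := (norm_add_le _ _).trans (by linarith)
  · obtain ⟨C, η₀, hη₀, -, h⟩ := exists_error_bound_of_norm_le hL h0.le h1 hα R T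
    exact ⟨C, η₀, hη₀, h⟩
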